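/- Let $G$ be a topological group acting continuously on a compact Hausdorff space $X$ and let $f \in C(X)$ be a continuous real-valued function. Let $E = E(G,X) \subset X^X$ be the enveloping semigroup, i.e. the closure, in the topology of pointwise convergence, of the set of translations $\{x \mapsto gx : g \in G\}$. For $p \in E$ put $p_f := f \circ p : X \to \mathbb{R}$, and let $E^f := \{p_f : p \in E\}$. The following conditions are equivalent: 1. $f$ is an Asplund function: for every countable subgroup $H \le G$ the pseudometric space $(X, \rho_{H,f})$ is separable, where $\rho_{H,f}(x,y) = \sup_{h \in H} |f(hx) - f(hy)|$. 2. $E^f$ is a fragmented family: for every nonempty subset $A \subset X$ and every $\varepsilon > 0$ there is an open set $O \subset X$ with $O \cap A \neq \emptyset$ such that $|p_f(x) - p_f(y)| < \varepsilon$ for all $x, y \in O \cap A$ and all $p \in E$. 3. $E^f$ is a barely continuous family: every nonempty closed subset $A \subset X$ contains a point $a$ at which the family of restrictions $\{p_f|_A : p \in E\}$ is equicontinuous. 4. For every closed subset $Y \subset X$ there is a dense $G_\delta$ subset $Y_0$ of $Y$ such that the restriction $p_f|_{Y_0} : Y_0 \to \mathbb{R}$ is continuous for every $p \in E$. 5.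 For every closed $G$-invariant subset $Y \subset X$ there is a dense $G_\delta$ subset $Y_0$ of $Y$ such that the restriction $p_f|_{Y_0} : Y_0 \to \mathbb{R}$ is continuous for every $p \in E$. -/

import Mathlib

open Topology

/-- `ρ_{H,f}(x, y) = sup_{h ∈ H} |f (h x) - f (h y)|`. -/
noncomputable def orbitDist {G X : Type*} [Group G] [MulAction G X] [TopologicalSpace X]
    (H : Subgroup G) (f : C(X, ℝ)) (x y : X) : ℝ :=
  ⨆ h : H, |f ((h : G) • x) - f ((h : G) • y)|

theorem orbitDist_bddAbove {G X : Type*} [Group G] [MulAction G X] [TopologicalSpace X]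
    [CompactSpace X] (H : Subgroup G) (f : C(X, ℝ)) (x y : X) :
    BddAbove (Set.range fun h : H => |f ((h : G) • x) - f ((h : G) • y)|) := by
  refine ⟨2 * ‖f‖, ?_⟩
  rintro _ ⟨h, rfl⟩
  have h1 := f.norm_coe_le_norm ((h : G) • x)
  have h2 := f.norm_coe_le_norm ((h : G) • y)
  rw [Real.norm_eq_abs] at h1 h2
  have h3 := abs_sub (f ((h : G) • x)) (f ((h : G) • y))
  show |f ((h : G) • x) - f ((h : G) • y)| ≤ 2 * ‖f‖
  linarith

/-- The pseudometric space `(X, ρ_{H,f})` for a compact `X`. -/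
@[reducible]
noncomputable def orbitPseudoMetric {G X : Type*} [Group G] [MulAction G X] [TopologicalSpace X]
    [CompactSpace X] (H : Subgroup G) (f : C(X, ℝ)) : PseudoMetricSpace X where
  dist := orbitDist H f
  dist_self x := by simp [orbitDist]
  dist_comm x y := by simp only [orbitDist, abs_sub_comm]
  dist_triangle x y z := by
    refine ciSup_le fun h => ?_
    have h1 := le_ciSup (orbitDist_bddAbove H f x y) h
    have h2 := le_ciSup (orbitDist_bddAbove H f y z) h
    have h3 := abs_sub_le (f ((h : G) • x)) (f ((h : G) • y)) (f ((h : G) • z))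
    exact h3.trans (add_le_add h1 h2)

/-- `f` is an Asplund function on the compact `G`-space `X`: the pseudometric space
`(X, ρ_{H,f})` is separable for every countable subgroup `H` of `G`. -/
def IsAsplundFunction (G : Type*) {X : Type*} [Group G] [MulAction G X] [TopologicalSpace X]
    [CompactSpace X] (f : C(X, ℝ)) : Prop :=
  ∀ H : Subgroup G, Countable H →
    @TopologicalSpace.SeparableSpace X
      (orbitPseudoMetric H f).toUniformSpace.toTopologicalSpace

/-- The enveloping (Ellis) semigroup: the closure of the set of translations `x ↦ g x`
in `X → X` with the topology of pointwise convergence. -/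
def envelopingSemigroup (G X : Type*) [Group G] [MulAction G X] [TopologicalSpace X] :
    Set (X → X) :=
  closure (Set.range fun (g : G) (x : X) => g • x)

/-- The family `E^f` of all functions `p_f = f ∘ p`, where `p` runs over the enveloping
semigroup. -/
def envelopingFamily (G : Type*) {X : Type*} [Group G] [MulAction G X] [TopologicalSpace X]
    (f : C(X, ℝ)) : Set (X → ℝ) :=
  (fun (p : X → X) (x : X) => f (p x)) '' envelopingSemigroup G X

/-- A family of functions is fragmented if for every nonempty `A ⊆ X` and every entourage `ε`
there is an open `O` meeting `A` such that `φ (O ∩ A)` is `ε`-small for all `φ` in the family. -/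
def IsFragmentedFamily {X Y : Type*} [TopologicalSpace X] [UniformSpace Y]
    (F : Set (X → Y)) : Prop :=
  ∀ A : Set X, A.Nonempty → ∀ ε ∈ uniformity Y,
    ∃ O : Set X, IsOpen O ∧ (O ∩ A).Nonempty ∧
      ∀ φ ∈ F, (φ '' (O ∩ A)) ×ˢ (φ '' (O ∩ A)) ⊆ ε

/-- A family of functions is barely continuous if every nonempty closed `A ⊆ X` has a point at
which the family of restrictions to `A` is equicontinuous. -/
def IsBarelyContinuousFamily {X Y : Type*} [TopologicalSpace X] [UniformSpace Y]
    (F : Set (X → Y)) : Prop :=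
  ∀ A : Set X, IsClosed A → A.Nonempty →
    ∃ a : A, Set.EquicontinuousAt ((fun (φ : X → Y) (x : A) => φ (x : X)) '' F) a

/-- `Y` has a dense `G_δ` subset `Y₀` (relative to `Y`) such that `p_f = f ∘ p`, restricted to
`Y₀`, is continuous for every `p` in the enveloping semigroup of `X`. -/
def HasDenseGδContinuity (G : Type*) {X : Type*} [Group G] [MulAction G X] [TopologicalSpace X]
    (f : C(X, ℝ)) (Y : Set X) : Prop :=
  ∃ Y₀ : Set Y, IsGδ Y₀ ∧ Dense Y₀ ∧
    ∀ p ∈ envelopingSemigroup G X, Continuous fun y : Y₀ => f (p ((y : Y) : X))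

/-! All conditions are compared with one: the translates `x ↦ f (g • x)` have small oscillations.
Non-strict bounds on translates pass to pointwise limits, hence to all of `E^f`; Baire category then
yields points of zero oscillation, giving 3 and 4.

If small oscillation fails, a Cantor tree of open sets yields uncountably many points separated by
translates labelled by finite words. Those labels generate a countable subgroup, contradicting 1.
Under 5, the tree is built inside the dense `G_δ` set; its points have compact closure `C` there, on
which the whole pointwise compact family is continuous. A countable subfamily then has compact
metrizable closure `D`, and separability of `C(D, ℝ)` rules out the uncountable separated set.
Invariant sets suffice because the largest good open set is invariant.

Conversely, for countable `H` the map `x ↦ (f (h • x))_h` has second countable target, where small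
oscillations give countable nets. -/

/-- In a separable pseudometric space a uniformly separated family is countable. -/
theorem countable_of_separated_family {α T : Type*} [PseudoMetricSpace α]
    [TopologicalSpace.SeparableSpace α] (x : T → α) {ε : ℝ} (hε : 0 < ε)
    (h : ∀ s t, s ≠ t → ε ≤ dist (x s) (x t)) : Countable T := by
  cases isEmpty_or_nonempty T with
  | inl _ => infer_instance
  | inr hT =>
    have : Nonempty α := hT.map x
    have key : ∀ t, ∃ n, dist (x t) (TopologicalSpace.denseSeq α n) < ε / 2 := fun t => by
      obtain ⟨_, hn, ⟨n, rfl⟩⟩ := Metric.dense_iff.1 (TopologicalSpace.denseRange_denseSeq α)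
        (x t) (ε / 2) (half_pos hε)
      exact ⟨n, by rw [dist_comm]; exact hn⟩
    choose n hn using key
    refine Function.Injective.countable (f := n) fun s t hst => ?_
    by_contra hne
    have h1 := h s t hne
    have h2 := hn s
    have h3 := hn t
    rw [← hst] at h3
    have h4 := dist_triangle_right (x s) (x t) (TopologicalSpace.denseSeq α (n s))
    linarith

theorem not_countable_nat_bool : ¬ Countable (ℕ → Bool) := by
  intro h
  obtain ⟨e, he⟩ := exists_surjective_nat (ℕ → Bool)
  obtain ⟨n, hn⟩ := he fun k => !(e k k)
  have := congrFun hn n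
  simp at this

/-- A countable family of functions on a compact space, contained in a pointwise compact set of
continuous functions, induces a separable pseudometric. -/
theorem countable_of_separated_of_isCompact {C κ T : Type*} [TopologicalSpace C] [CompactSpace C]
    [Countable κ] (F : κ → C → ℝ) {K : Set (C → ℝ)} (hK : IsCompact K)
    (hKc : ∀ φ ∈ K, Continuous φ) (hF : ∀ n, F n ∈ K) (x : T → C) {ε : ℝ} (hε : 0 < ε)
    (h : ∀ s t, s ≠ t → ∃ n, ε ≤ |F n (x s) - F n (x t)|) : Countable T := by
  set D : Set (C → ℝ) := closure (Set.range F) with hD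
  have hDK : D ⊆ K := closure_minimal (Set.range_subset_iff.2 hF) hK.isClosed
  have hDc : IsCompact D := hK.of_isClosed_subset isClosed_closure hDK
  have : CompactSpace D := isCompact_iff_compactSpace.1 hDc
  let π : C → κ → ℝ := fun y n => F n y
  have hπ : Continuous π := continuous_pi fun n => hKc _ (hF n)
  have hfib : ∀ φ ∈ D, ∀ y z, π y = π z → φ y = φ z := by
    intro φ hφ y z hyz
    have hcl : IsClosed {ψ : C → ℝ | ψ y = ψ z} :=
      isClosed_eq (continuous_apply y) (continuous_apply z)
    refine closure_minimal ?_ hcl hφ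
    rintro _ ⟨n, rfl⟩
    exact congrFun hyz n
  obtain ⟨S, hSc, hS⟩ := TopologicalSpace.exists_countable_dense (Set.range π)
  choose c hc using fun s : S => s.1.2
  have : Countable S := hSc
  let r : D → S → ℝ := fun φ s => φ.1 (c s)
  have hr : Continuous r :=
    continuous_pi fun s => (continuous_apply (c s)).comp continuous_subtype_val
  -- The agreement set of two limits has closed image under `π` containing the dense set `S`, so it
  -- meets every fibre; both limits are constant on fibres.
  have hrinj : Function.Injective r := by
    intro φ ψ hφψ
    have hcl : IsClosed {y | φ.1 y = ψ.1 y} :=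
      isClosed_eq (hKc _ (hDK φ.2)) (hKc _ (hDK ψ.2))
    have him : IsClosed (Subtype.val ⁻¹' (π '' {y | φ.1 y = ψ.1 y}) : Set (Set.range π)) :=
      (hπ.isClosedMap _ hcl).preimage continuous_subtype_val
    have hsub : S ⊆ (Subtype.val ⁻¹' (π '' {y | φ.1 y = ψ.1 y}) : Set (Set.range π)) :=
      fun s hs => ⟨c ⟨s, hs⟩, congrFun hφψ ⟨s, hs⟩, hc ⟨s, hs⟩⟩
    ext y
    obtain ⟨z, hz, hzy⟩ := him.closure_subset_iff.2 hsub (hS ⟨π y, y, rfl⟩)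
    rw [← hfib _ φ.2 z y hzy, ← hfib _ ψ.2 z y hzy]
    exact hz
  have : SecondCountableTopology D :=
    (hr.isClosedEmbedding hrinj).isEmbedding.secondCountableTopology
  let ev : C → C(D, ℝ) := fun y =>
    ⟨fun φ => φ.1 y, (continuous_apply y).comp continuous_subtype_val⟩
  refine countable_of_separated_family (fun t => ev (x t)) hε fun s t hst => ?_
  obtain ⟨n, hn⟩ := h s t hst
  refine hn.trans ?_
  have := ContinuousMap.dist_apply_le_dist (f := ev (x s)) (g := ev (x t))
    ⟨F n, subset_closure ⟨n, rfl⟩⟩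
  rwa [Real.dist_eq] at this

/-! ### Cantor schemes of open sets -/

/-- The strict inequality is open, so `x` and `y` can be moved into the dense set `V`; regularity
then shrinks the neighbourhoods. Separation is kept on closures because the branch points are only
known to lie there. -/
theorem exists_separated_open_pair {Y : Type*} [TopologicalSpace Y] [RegularSpace Y]
    (φ : C(Y, ℝ)) {ε : ℝ} {O V : Set Y} (hO : IsOpen O) (hV : IsOpen V) (hVd : Dense V)
    {x y : Y} (hx : x ∈ O) (hy : y ∈ O) (hxy : ε < |φ x - φ y|) :
    ∃ P : Bool → Set Y, (∀ b, IsOpen (P b) ∧ (P b).Nonempty ∧ closure (P b) ⊆ O ∩ V) ∧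
      ∀ a ∈ closure (P true), ∀ b ∈ closure (P false), ε < |φ a - φ b| := by
  have hopen : IsOpen {q : Y × Y | ε < |φ q.1 - φ q.2|} :=
    isOpen_lt continuous_const (by fun_prop)
  obtain ⟨A, B, hA, hB, hxA, hyB, hAB⟩ := isOpen_prod_iff.1 hopen x y hxy
  have shrink : ∀ A : Set Y, IsOpen A → ∀ x ∈ A, x ∈ O →
      ∃ P, IsOpen P ∧ P.Nonempty ∧ closure P ⊆ A ∩ (O ∩ V) := by
    intro A hA x hxA hxO
    obtain ⟨z, hz, hzV⟩ := hVd.inter_open_nonempty (A ∩ O) (hA.inter hO) ⟨x, hxA, hxO⟩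
    obtain ⟨W, hW, hWcl, hWs⟩ := exists_mem_nhds_isClosed_subset
      (((hA.inter hO).inter hV).mem_nhds ⟨hz, hzV⟩)
    refine ⟨interior W, isOpen_interior, ⟨z, mem_interior_iff_mem_nhds.2 hW⟩, ?_⟩
    intro w hw
    have := hWs (closure_minimal interior_subset hWcl hw)
    exact ⟨this.1.1, this.1.2, this.2⟩
  obtain ⟨P, hP, hPn, hPs⟩ := shrink A hA x hxA hx
  obtain ⟨Q, hQ, hQn, hQs⟩ := shrink B hB y hyB hy
  refine ⟨fun b => bif b then P else Q, ?_, ?_⟩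
  · rintro (_ | _)
    · exact ⟨hQ, hQn, fun w hw => (hQs hw).2⟩
    · exact ⟨hP, hPn, fun w hw => (hPs hw).2⟩
  · intro a ha b hb
    exact hAB (Set.mk_mem_prod (hPs ha).1 (hQs hb).1)

/-- The list of the first `n` digits of a sequence, the latest digit first. -/
def digitList (s : ℕ → Bool) : ℕ → List Bool
  | 0 => []
  | n + 1 => s n :: digitList s n

theorem length_digitList (s : ℕ → Bool) (n : ℕ) : (digitList s n).length = n := by
  induction n with
  | zero => rfl
  | succ n ih => simp [digitList, ih]

theorem digitList_congr {s t : ℕ → Bool} {n : ℕ} (h : ∀ m < n, s m = t m) :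
    digitList s n = digitList t n := by
  induction n with
  | zero => rfl
  | succ n ih =>
    simp only [digitList]
    rw [h n n.lt_succ_self, ih fun m hm => h m (hm.trans n.lt_succ_self)]

/-- If every nonempty open set carries an oscillation larger than `ε` of some member of a family
of continuous functions on a compact space, then a Cantor set of points is `ε`-separated by a
countable subfamily; moreover these points accumulate only inside a prescribed dense `G_δ`. -/
theorem exists_cantor_tree {Y ι : Type*} [TopologicalSpace Y] [CompactSpace Y] [T2Space Y]
    [Nonempty Y] (φ : ι → C(Y, ℝ)) {V : ℕ → Set Y} (hV : ∀ n, IsOpen (V n))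
    (hVd : ∀ n, Dense (V n)) {ε : ℝ}
    (bad : ∀ O : Set Y, IsOpen O → O.Nonempty → ∃ i, ∃ x ∈ O, ∃ y ∈ O, ε < |φ i x - φ i y|) :
    ∃ (N : List Bool → ι) (x : (ℕ → Bool) → Y), closure (Set.range x) ⊆ ⋂ n, V n ∧
      ∀ s t, s ≠ t → ∃ l, ε < |φ (N l) (x s) - φ (N l) (x t)| := by
  have step : ∀ (O : {O : Set Y // IsOpen O ∧ O.Nonempty}) (n : ℕ), ∃ (i : ι)
      (P : Bool → {O : Set Y // IsOpen O ∧ O.Nonempty}),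
      (∀ b, closure (P b).1 ⊆ O.1 ∩ V n) ∧
      ∀ a ∈ closure (P true).1, ∀ b ∈ closure (P false).1, ε < |φ i a - φ i b| := by
    rintro ⟨O, hO, hOn⟩ n
    obtain ⟨i, x, hx, y, hy, hxy⟩ := bad O hO hOn
    obtain ⟨P, hP, hPs⟩ := exists_separated_open_pair (φ i) hO (hV n) (hVd n) hx hy hxy
    exact ⟨i, fun b => ⟨P b, (hP b).1, (hP b).2.1⟩, fun b => (hP b).2.2, hPs⟩
  choose i P hP hPs using step
  -- The word length selects the dense open set that the children must enter.
  let O : List Bool → {O : Set Y // IsOpen O ∧ O.Nonempty} := fun l =>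
    List.rec ⟨Set.univ, isOpen_univ, Set.univ_nonempty⟩ (fun b l' o => P o l'.length b) l
  have hOc : ∀ b l, O (b :: l) = P (O l) l.length b := fun b l => rfl
  have hne : ∀ s : ℕ → Bool, (⋂ n, closure (O (digitList s n)).1).Nonempty := by
    intro s
    refine IsCompact.nonempty_iInter_of_sequence_nonempty_isCompact_isClosed _ ?_ ?_ ?_ ?_
    · intro n
      exact (hP _ _ _).trans (Set.inter_subset_left.trans subset_closure)
    · exact fun n => (O (digitList s n)).2.2.closure
    · exact isClosed_closure.isCompact
    · exact fun n => isClosed_closure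
  choose x hx using hne
  have hx' : ∀ s n, x s ∈ closure (O (digitList s n)).1 := fun s => Set.mem_iInter.1 (hx s)
  refine ⟨fun l => i (O l) l.length, x, ?_, ?_⟩
  · refine Set.subset_iInter fun n => ?_
    -- Each level is finite, so the union of its closures is closed and also captures accumulation
    -- points of branches.
    have hfin : {l : List Bool | l.length = n + 1}.Finite := List.finite_length_eq Bool (n + 1)
    have hcl : IsClosed (⋃ l ∈ {l : List Bool | l.length = n + 1}, closure (O l).1) :=
      hfin.isClosed_biUnion fun l _ => isClosed_closure
    have hsub : closure (Set.range x) ⊆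
        ⋃ l ∈ {l : List Bool | l.length = n + 1}, closure (O l).1 := by
      refine closure_minimal ?_ hcl
      rintro _ ⟨s, rfl⟩
      exact Set.mem_biUnion (length_digitList s (n + 1)) (hx' s (n + 1))
    refine hsub.trans (Set.iUnion₂_subset ?_)
    rintro (_ | ⟨b, l⟩) hl
    · simp at hl
    · have hl' : l.length = n := by simpa using hl
      subst hl'
      exact (hP _ _ _).trans Set.inter_subset_right
  · intro s t hst
    have hex : ∃ n, s n ≠ t n := Function.ne_iff.1 hst
    classical
    have hn := Nat.find_spec hex
    have hmin : ∀ m < Nat.find hex, s m = t m := fun m hm => not_not.1 (Nat.find_min hex hm)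
    generalize Nat.find hex = n at hn hmin
    have hst' := digitList_congr hmin
    -- The separating label sits at the longest common prefix of `s` and `t`.
    refine ⟨digitList s n, ?_⟩
    have h1 := hx' s (n + 1)
    have h2 := hx' t (n + 1)
    simp only [digitList, hOc] at h1 h2
    rw [← hst'] at h2
    cases hs : s n <;> cases ht : t n <;> rw [hs] at h1 <;> rw [ht] at h2
    · exact absurd (hs.trans ht.symm) hn
    · rw [abs_sub_comm]
      exact hPs _ _ _ h2 _ h1
    · exact hPs _ _ _ h1 _ h2
    · exact absurd (hs.trans ht.symm) hn

/-- Every nonempty set has nonempty relatively open subsets on which all members of the family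
oscillate by at most `ε`. -/
def HasSmallOscillations {X ι : Type*} [TopologicalSpace X] (φ : ι → X → ℝ) : Prop :=
  ∀ A : Set X, A.Nonempty → ∀ ε > 0, ∃ O : Set X, IsOpen O ∧ (O ∩ A).Nonempty ∧
    ∀ i, ∀ x ∈ O ∩ A, ∀ y ∈ O ∩ A, |φ i x - φ i y| ≤ ε

/-! ### Small oscillations, Namioka's theorem and separability -/

section Family

variable {X ι : Type*} [TopologicalSpace X]

/-- On a compact space a family of continuous functions that does not have small oscillations
`ε`-separates an uncountable set by means of a countable subfamily. -/
theorem hasSmallOscillations_of_countable_separated [CompactSpace X] [T2Space X]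
    (φ : ι → C(X, ℝ))
    (h : ∀ (N : List Bool → ι) (x : (ℕ → Bool) → X) (ε : ℝ), 0 < ε →
      ¬ ∀ s t, s ≠ t → ∃ l, ε < |φ (N l) (x s) - φ (N l) (x t)|) :
    HasSmallOscillations fun i => φ i := by
  intro A hA ε hε
  by_contra hcon
  push Not at hcon
  have : CompactSpace (closure A) := isCompact_iff_compactSpace.1 isClosed_closure.isCompact
  have : Nonempty (closure A) := hA.closure.to_subtype
  obtain ⟨N, x, -, hx⟩ := exists_cantor_tree (Y := closure A)
    (fun i => (φ i).restrict (closure A)) (V := fun _ => Set.univ) (fun _ => isOpen_univ)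
    (fun _ => dense_univ) (ε := ε) (by
      rintro O hO ⟨z, hz⟩
      obtain ⟨W, hW, rfl⟩ := isOpen_induced_iff.1 hO
      obtain ⟨i, a, ha, b, hb, hab⟩ := hcon W hW (mem_closure_iff.1 z.2 W hW hz)
      exact ⟨i, ⟨a, subset_closure ha.2⟩, ha.1, ⟨b, subset_closure hb.2⟩, hb.1, hab⟩)
  exact h N (fun s => (x s : X)) ε hε hx

/-- A form of Namioka's theorem: if all functions of a pointwise compact set `K` are continuous on a
dense `G_δ` set, then a family of continuous functions contained in `K` has small oscillations on
some nonempty open set. -/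
theorem exists_open_small_oscillation_of_isGδ {Y : Type*} [TopologicalSpace Y] [CompactSpace Y]
    [T2Space Y] [Nonempty Y] (φ : ι → C(Y, ℝ)) {K : Set (Y → ℝ)} (hK : IsCompact K)
    (hφ : ∀ i, ⇑(φ i) ∈ K) {Y₀ : Set Y} (hG : IsGδ Y₀) (hd : Dense Y₀)
    (hc : ∀ ψ ∈ K, ContinuousOn ψ Y₀) {ε : ℝ} (hε : 0 < ε) :
    ∃ O : Set Y, IsOpen O ∧ O.Nonempty ∧ ∀ i, ∀ x ∈ O, ∀ y ∈ O, |φ i x - φ i y| ≤ ε := by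
  by_contra hcon
  push Not at hcon
  obtain ⟨V, hV, rfl⟩ := hG.eq_iInter_nat
  obtain ⟨N, x, hxV, hx⟩ := exists_cantor_tree φ hV (fun n => hd.mono (Set.iInter_subset V n)) hcon
  have : CompactSpace (closure (Set.range x)) :=
    isCompact_iff_compactSpace.1 isClosed_closure.isCompact
  refine not_countable_nat_bool (countable_of_separated_of_isCompact
    (C := closure (Set.range x)) (fun l z => φ (N l) z)
    (K := (fun ψ z => ψ (z : Y)) '' K) ?_ ?_ ?_ (fun s => ⟨x s, subset_closure ⟨s, rfl⟩⟩) hε ?_)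
  · exact hK.image (continuous_pi fun z => continuous_apply (z : Y))
  · rintro _ ⟨ψ, hψ, rfl⟩
    exact ((hc ψ hψ).mono hxV).domRestrict
  · exact fun l => ⟨_, hφ (N l), rfl⟩
  · intro s t hst
    obtain ⟨l, hl⟩ := hx s t hst
    exact ⟨l, hl.le⟩

/-- Among the closed subsets of `A` whose image contains `T` there is a minimal one. -/
theorem exists_minimal_isClosed_image {Z : Type*} [TopologicalSpace Z] [T1Space Z]
    [CompactSpace X] {π : X → Z} (hπ : Continuous π) {A : Set X} (hA : IsClosed A) {T : Set Z}
    (hT : T ⊆ π '' A) : ∃ B ⊆ A, IsClosed B ∧ T ⊆ π '' B ∧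
      ∀ B' ⊆ B, IsClosed B' → T ⊆ π '' B' → B' = B := by
  obtain ⟨B, hBA, hB⟩ := zorn_superset_nonempty {B : Set X | IsClosed B ∧ T ⊆ π '' B} (by
    intro c hc hchain hne
    refine ⟨⋂₀ c, ⟨isClosed_sInter fun B hB => (hc hB).1, fun t ht => ?_⟩,
      fun B hB => Set.sInter_subset_of_mem hB⟩
    have := hne.to_subtype
    have hcl : ∀ B : c, IsClosed ((B : Set X) ∩ π ⁻¹' {t}) := fun B =>
      (hc B.2).1.inter (isClosed_singleton.preimage hπ)
    obtain ⟨x, hx⟩ := IsCompact.nonempty_iInter_of_directed_nonempty_isCompact_isClosed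
      (fun B : c => (B : Set X) ∩ π ⁻¹' {t})
      (fun B B' => by
        rcases hchain.total B.2 B'.2 with hle | hle
        · exact ⟨B, subset_rfl, Set.inter_subset_inter_left _ hle⟩
        · exact ⟨B', Set.inter_subset_inter_left _ hle, subset_rfl⟩)
      (fun B => by
        obtain ⟨x, hx, hxt⟩ := (hc B.2).2 ht
        exact ⟨x, hx, hxt⟩)
      (fun B => (hcl B).isCompact) hcl
    rw [Set.mem_iInter] at hx
    exact ⟨x, fun B hB => (hx ⟨B, hB⟩).1, (hx ⟨_, hne.some_mem⟩).2⟩) A ⟨hA, hT⟩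
  exact ⟨B, hBA, hB.prop.1, hB.prop.2,
    fun B' hB' hcl hTB' => hB.eq_of_subset ⟨hcl, hTB'⟩ hB'⟩

/-- A countable family of continuous functions with small oscillations on a compact space induces a
separable pseudometric. -/
theorem HasSmallOscillations.exists_countable_dense [CompactSpace X] [Countable ι]
    {φ : ι → X → ℝ} (hφ : ∀ i, Continuous (φ i)) (h : HasSmallOscillations φ) {ε : ℝ}
    (hε : 0 < ε) : ∃ S : Set X, S.Countable ∧ ∀ x, ∃ s ∈ S, ∀ i, |φ i x - φ i s| ≤ ε := by
  let π : X → ι → ℝ := fun x i => φ i x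
  have hπ : Continuous π := continuous_pi hφ
  have local_small : ∀ Z : Set (ι → ℝ), IsClosed Z → (π ⁻¹' Z).Nonempty → ∃ W : Set (ι → ℝ),
      IsOpen W ∧ (π ⁻¹' (W ∩ Z)).Nonempty ∧
        ∀ i, ∀ x ∈ π ⁻¹' (W ∩ Z), ∀ y ∈ π ⁻¹' (W ∩ Z), |φ i x - φ i y| ≤ ε := by
    intro Z hZ hne
    -- By minimality, deleting the small piece `O` from `B` loses part of the image. Over that lost
    -- part every fibre has a representative in `O ∩ B`, so smallness descends to an open set in the
    -- target.
    obtain ⟨B, hBZ, hB, hBs, hBmin⟩ := exists_minimal_isClosed_image hπ (hZ.preimage hπ)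
      (T := π '' (π ⁻¹' Z)) subset_rfl
    have hBne : B.Nonempty := Set.image_nonempty.1 ((hne.image π).mono hBs)
    obtain ⟨O, hO, ⟨b, hbO, hbB⟩, hsmall⟩ := h B hBne ε hε
    have hnot : ¬ π '' (π ⁻¹' Z) ⊆ π '' (B \ O) := fun hsub => by
      have hb : b ∈ B \ O := (hBmin _ Set.sdiff_subset (hB.sdiff hO) hsub).symm ▸ hbB
      exact hb.2 hbO
    obtain ⟨_, ⟨w, hwZ, rfl⟩, hw⟩ := Set.not_subset.1 hnot
    have hcl : IsClosed (π '' (B \ O)) := hπ.isClosedMap _ (hB.sdiff hO)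
    refine ⟨_, hcl.isOpen_compl, ⟨w, hw, hwZ⟩, ?_⟩
    have lift : ∀ x ∈ π ⁻¹' ((π '' (B \ O))ᶜ ∩ Z), ∃ y ∈ O ∩ B, π y = π x := by
      rintro x ⟨hx, hxZ⟩
      obtain ⟨y, hyB, hyx⟩ := hBs ⟨x, hxZ, rfl⟩
      refine ⟨y, ⟨?_, hyB⟩, hyx⟩
      by_contra hyO
      exact hx ⟨y, ⟨hyB, hyO⟩, hyx⟩
    intro i x hx y hy
    obtain ⟨x', hx', hxx⟩ := lift x hx
    obtain ⟨y', hy', hyy⟩ := lift y hy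
    have := hsmall i x' hx' y' hy'
    rwa [show φ i x' = φ i x from congrFun hxx i, show φ i y' = φ i y from congrFun hyy i] at this
  let P : Set X → Prop := fun A =>
    ∃ S : Set X, S.Countable ∧ ∀ x ∈ A, ∃ s ∈ S, ∀ i, |φ i x - φ i s| ≤ ε
  -- Exhaustion: if these basic sets left a remainder, a basic neighbourhood of some point `z` in it
  -- would need only the extra net point `z`, hence belong to `𝒰`.
  let 𝒰 : Set (Set (ι → ℝ)) := {W ∈ TopologicalSpace.countableBasis (ι → ℝ) | P (π ⁻¹' W)}
  have h𝒰c : 𝒰.Countable := (TopologicalSpace.countable_countableBasis _).mono fun W hW => hW.1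
  have hU : P (π ⁻¹' ⋃₀ 𝒰) := by
    choose! S hS hSd using fun W (hW : W ∈ 𝒰) => hW.2
    refine ⟨⋃ W ∈ 𝒰, S W, h𝒰c.biUnion hS, ?_⟩
    rintro x ⟨W, hW, hxW⟩
    obtain ⟨s, hs, hxs⟩ := hSd W hW x hxW
    exact ⟨s, Set.mem_biUnion hW hs, hxs⟩
  have hopen : IsOpen (⋃₀ 𝒰) :=
    isOpen_sUnion fun W hW => TopologicalSpace.isOpen_of_mem_countableBasis hW.1
  by_cases hne : (π ⁻¹' (⋃₀ 𝒰)ᶜ).Nonempty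
  · obtain ⟨W, hW, ⟨z, hzW, hz⟩, hsmall⟩ := local_small _ hopen.isClosed_compl hne
    obtain ⟨W', hW', hzW', hWW'⟩ := (TopologicalSpace.isBasis_countableBasis
      (ι → ℝ)).exists_subset_of_mem_open hzW hW
    refine absurd ⟨W', ⟨hW', ?_⟩, hzW'⟩ hz
    obtain ⟨S, hS, hSd⟩ := hU
    refine ⟨insert z S, hS.insert z, fun x hx => ?_⟩
    by_cases hxU : x ∈ π ⁻¹' ⋃₀ 𝒰
    · obtain ⟨s, hs, hxs⟩ := hSd x hxU
      exact ⟨s, Set.mem_insert_of_mem _ hs, hxs⟩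
    · exact ⟨z, Set.mem_insert _ _, fun i => hsmall i x ⟨hWW' hx, hxU⟩ z ⟨hzW, hz⟩⟩
  · obtain ⟨S, hS, hSd⟩ := hU
    refine ⟨S, hS, fun x => hSd x ?_⟩
    by_contra hx
    exact hne ⟨x, hx⟩

end Family

/-! ### Translates and the enveloping semigroup -/

section Action

variable {G X : Type*} [Group G] [TopologicalSpace X] [MulAction G X]

theorem countable_subgroup_closure {s : Set G} (hs : s.Countable) :
    Countable (Subgroup.closure s) := by
  have := hs.to_subtype
  have : Countable (FreeGroup s) := Quot.mk_surjective.countable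
  rw [FreeGroup.closure_eq_range]
  exact (Set.countable_range (FreeGroup.lift ((↑) : s → G))).to_subtype

theorem smul_mem_envelopingSemigroup (g : G) :
    (fun x : X => g • x) ∈ envelopingSemigroup G X :=
  subset_closure ⟨g, rfl⟩

theorem smul_mem_envelopingFamily (f : C(X, ℝ)) (g : G) :
    (fun x : X => f (g • x)) ∈ envelopingFamily G f :=
  ⟨_, smul_mem_envelopingSemigroup g, rfl⟩

theorem abs_sub_le_of_mem_envelopingSemigroup (f : C(X, ℝ)) {x y : X} {ε : ℝ}
    (h : ∀ g : G, |f (g • x) - f (g • y)| ≤ ε) {p : X → X} (hp : p ∈ envelopingSemigroup G X) :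
    |f (p x) - f (p y)| ≤ ε := by
  have hcl : IsClosed {p : X → X | |f (p x) - f (p y)| ≤ ε} :=
    isClosed_le (((f.continuous.comp (continuous_apply x)).sub
      (f.continuous.comp (continuous_apply y))).abs) continuous_const
  refine closure_minimal ?_ hcl hp
  rintro _ ⟨g, rfl⟩
  exact h g

theorem isCompact_envelopingFamily [CompactSpace X] (f : C(X, ℝ)) :
    IsCompact (envelopingFamily G f) :=
  (isClosed_closure.isCompact).image
    (continuous_pi fun x => f.continuous.comp (continuous_apply x))

/-- Passing to limits keeps only a non-strict bound; halving `ε` restores the strict one. -/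
theorem isFragmentedFamily_envelopingFamily_iff (f : C(X, ℝ)) :
    IsFragmentedFamily (envelopingFamily G f) ↔
      HasSmallOscillations fun (g : G) (x : X) => f (g • x) := by
  constructor
  · intro h A hA ε hε
    obtain ⟨O, hO, hOA, hsmall⟩ := h A hA _ (Metric.dist_mem_uniformity hε)
    refine ⟨O, hO, hOA, fun g x hx y hy => ?_⟩
    have := hsmall _ (smul_mem_envelopingFamily f g) (Set.mk_mem_prod ⟨x, hx, rfl⟩ ⟨y, hy, rfl⟩)
    exact le_of_lt this
  · intro h A hA s hs
    obtain ⟨ε, hε, hεs⟩ := Metric.mem_uniformity_dist.1 hs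
    obtain ⟨O, hO, hOA, hsmall⟩ := h A hA (ε / 2) (half_pos hε)
    refine ⟨O, hO, hOA, ?_⟩
    rintro _ ⟨p, hp, rfl⟩ ⟨_, _⟩ ⟨⟨x, hx, rfl⟩, ⟨y, hy, rfl⟩⟩
    refine hεs (lt_of_le_of_lt ?_ (half_lt_self hε))
    rw [Real.dist_eq]
    exact abs_sub_le_of_mem_envelopingSemigroup f (fun g => hsmall g x hx y hy) hp

/-- The points of a closed set at which a family with small oscillations has oscillation `0` form a
dense `G_δ` set. -/
theorem HasSmallOscillations.exists_isGδ_dense {ι : Type*} [CompactSpace X] [T2Space X]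
    {φ : ι → X → ℝ} (h : HasSmallOscillations φ) {Y : Set X} (hY : IsClosed Y) :
    ∃ Y₀ : Set Y, IsGδ Y₀ ∧ Dense Y₀ ∧ ∀ y ∈ Y₀, ∀ ε > 0, ∃ U : Set Y, IsOpen U ∧ y ∈ U ∧
      ∀ i, ∀ a ∈ U, ∀ b ∈ U, |φ i a - φ i b| ≤ ε := by
  have : CompactSpace Y := isCompact_iff_compactSpace.1 hY.isCompact
  let 𝒪 : ℝ → Set (Set Y) := fun ε =>
    {U | IsOpen U ∧ ∀ i, ∀ a ∈ U, ∀ b ∈ U, |φ i a - φ i b| ≤ ε}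
  have hopen : ∀ ε, IsOpen (⋃₀ 𝒪 ε) := fun ε => isOpen_sUnion fun U hU => hU.1
  have hdense : ∀ ε > 0, Dense (⋃₀ 𝒪 ε) := by
    intro ε hε
    rw [dense_iff_inter_open]
    rintro W hW hne
    obtain ⟨W', hW', rfl⟩ := isOpen_induced_iff.1 hW
    -- Applying the hypothesis to a relatively open subset of `Y` gives density.
    obtain ⟨O, hO, ⟨_, hzO, z, hzW, rfl⟩, hsmall⟩ := h (Subtype.val '' (Subtype.val ⁻¹' W' : Set Y))
      (hne.image _) ε hε
    refine ⟨z, hzW, Subtype.val ⁻¹' (O ∩ W'), ⟨(hO.inter hW').preimage continuous_subtype_val, ?_⟩,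
      hzO, hzW⟩
    exact fun i a ha b hb => hsmall i a ⟨ha.1, a, ha.2, rfl⟩ b ⟨hb.1, b, hb.2, rfl⟩
  refine ⟨⋂ n : ℕ, ⋃₀ 𝒪 (1 / (n + 1)), IsGδ.iInter_of_isOpen fun n => hopen _,
    dense_iInter_of_isOpen_nat (fun n => hopen _) fun n => hdense _ Nat.one_div_pos_of_nat, ?_⟩
  intro y hy ε hε
  obtain ⟨n, hn⟩ := exists_nat_one_div_lt hε
  obtain ⟨U, hU, hyU⟩ := Set.mem_iInter.1 hy n
  exact ⟨U, hU.1, hyU, fun i a ha b hb => (hU.2 i a ha b hb).trans hn.le⟩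

theorem HasSmallOscillations.isBarelyContinuousFamily [CompactSpace X] [T2Space X] {f : C(X, ℝ)}
    (h : HasSmallOscillations fun (g : G) (x : X) => f (g • x)) :
    IsBarelyContinuousFamily (envelopingFamily G f) := by
  intro A hA hne
  have : Nonempty A := hne.to_subtype
  obtain ⟨Y₀, -, hd, hosc⟩ := h.exists_isGδ_dense hA
  obtain ⟨a, ha⟩ := hd.nonempty
  refine ⟨a, Metric.equicontinuousAt_iff_right.2 fun ε hε => ?_⟩
  obtain ⟨U, hU, haU, hsmall⟩ := hosc a ha (ε / 2) (half_pos hε)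
  filter_upwards [hU.mem_nhds haU] with x hx
  rintro ⟨_, _, ⟨p, hp, rfl⟩, rfl⟩
  rw [Real.dist_eq]
  exact lt_of_le_of_lt (abs_sub_le_of_mem_envelopingSemigroup f
    (fun g => hsmall g a haU x hx) hp) (half_lt_self hε)

theorem HasSmallOscillations.hasDenseGδContinuity [CompactSpace X] [T2Space X] {f : C(X, ℝ)}
    (h : HasSmallOscillations fun (g : G) (x : X) => f (g • x)) {Y : Set X} (hY : IsClosed Y) :
    HasDenseGδContinuity G f Y := by
  obtain ⟨Y₀, hG, hd, hosc⟩ := h.exists_isGδ_dense hY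
  refine ⟨Y₀, hG, hd, fun p hp => continuous_iff_continuousAt.2 fun y => ?_⟩
  refine Metric.tendsto_nhds.2 fun ε hε => ?_
  obtain ⟨U, hU, hyU, hsmall⟩ := hosc y y.2 (ε / 2) (half_pos hε)
  filter_upwards [(hU.preimage continuous_subtype_val).mem_nhds hyU] with x hx
  rw [Real.dist_eq]
  exact lt_of_le_of_lt (abs_sub_le_of_mem_envelopingSemigroup f
    (fun g => hsmall g x hx y hyU) hp) (half_lt_self hε)

/-- A neighbourhood of an equicontinuity point of the closure of `A` still meets `A`. -/
theorem IsBarelyContinuousFamily.hasSmallOscillations {f : C(X, ℝ)}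
    (h : IsBarelyContinuousFamily (envelopingFamily G f)) :
    HasSmallOscillations fun (g : G) (x : X) => f (g • x) := by
  intro A hA ε hε
  obtain ⟨a, ha⟩ := h (closure A) isClosed_closure hA.closure
  have hnear := Metric.equicontinuousAt_iff_right.1 ha (ε / 2) (half_pos hε)
  obtain ⟨U, hUs, hU, haU⟩ := eventually_nhds_iff.1 hnear
  obtain ⟨W, hW, rfl⟩ := isOpen_induced_iff.1 hU
  refine ⟨W, hW, mem_closure_iff.1 a.2 W hW haU, fun g x hx y hy => ?_⟩
  have key : ∀ z ∈ W ∩ A, dist (f (g • (a : X))) (f (g • z)) < ε / 2 := fun z hz =>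
    hUs ⟨z, subset_closure hz.2⟩ hz.1 ⟨_, _, smul_mem_envelopingFamily f g, rfl⟩
  have h1 := dist_triangle_left (f (g • x)) (f (g • y)) (f (g • (a : X)))
  rw [← Real.dist_eq]
  linarith [key x hx, key y hy]

theorem IsAsplundFunction.hasSmallOscillations [CompactSpace X] [T2Space X]
    [ContinuousConstSMul G X] {f : C(X, ℝ)} (h : IsAsplundFunction G f) :
    HasSmallOscillations fun (g : G) (x : X) => f (g • x) := by
  refine hasSmallOscillations_of_countable_separated
    (fun g : G => ⟨fun x => f (g • x), by fun_prop⟩) fun N x ε hε hsep => ?_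
  let H := Subgroup.closure (Set.range N)
  have hH : Countable H := countable_subgroup_closure (Set.countable_range N)
  let _ := orbitPseudoMetric H f
  have := h H hH
  refine not_countable_nat_bool (countable_of_separated_family x hε fun s t hst => ?_)
  obtain ⟨l, hl⟩ := hsep s t hst
  exact hl.le.trans (le_ciSup (orbitDist_bddAbove H f (x s) (x t))
    ⟨N l, Subgroup.subset_closure ⟨l, rfl⟩⟩)

theorem HasSmallOscillations.isAsplundFunction [CompactSpace X] [ContinuousConstSMul G X]
    {f : C(X, ℝ)} (h : HasSmallOscillations fun (g : G) (x : X) => f (g • x)) :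
    IsAsplundFunction G f := by
  intro H hH
  have hHf : HasSmallOscillations fun (g : H) (x : X) => f ((g : G) • x) := fun A hA ε hε => by
    obtain ⟨O, hO, hOA, hsmall⟩ := h A hA ε hε
    exact ⟨O, hO, hOA, fun g => hsmall g⟩
  have hdense := fun (ε : ℝ) (hε : ε > 0) =>
    hHf.exists_countable_dense (fun g => by fun_prop) hε
  let _ := orbitPseudoMetric H f
  have : @SecondCountableTopology X (orbitPseudoMetric H f).toUniformSpace.toTopologicalSpace := by
    refine Metric.secondCountable_of_almost_dense_set fun ε hε => ?_
    obtain ⟨S, hS, hSd⟩ := hdense ε hε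
    refine ⟨S, hS, fun x => ?_⟩
    obtain ⟨s, hs, hxs⟩ := hSd x
    exact ⟨s, hs, ciSup_le hxs⟩
  exact @TopologicalSpace.SecondCountableTopology.to_separableSpace X
    (orbitPseudoMetric H f).toUniformSpace.toTopologicalSpace this

/-- It suffices to find small oscillations on closed invariant sets. -/
theorem hasSmallOscillations_of_invariant [ContinuousConstSMul G X] {f : X → ℝ}
    (h : ∀ Y : Set X, IsClosed Y → (∀ g : G, ∀ y ∈ Y, g • y ∈ Y) → Y.Nonempty → ∀ ε > 0,
      ∃ O : Set X, IsOpen O ∧ (O ∩ Y).Nonempty ∧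
        ∀ g : G, ∀ x ∈ O ∩ Y, ∀ y ∈ O ∩ Y, |f (g • x) - f (g • y)| ≤ ε) :
    HasSmallOscillations fun (g : G) (x : X) => f (g • x) := by
  intro A₀ hA₀ ε hε
  let small : Set X → Prop := fun A => ∃ O : Set X, IsOpen O ∧ (O ∩ A).Nonempty ∧
    ∀ g : G, ∀ x ∈ O ∩ A, ∀ y ∈ O ∩ A, |f (g • x) - f (g • y)| ≤ ε
  -- For the fixed `ε`, the union of `𝒰` is its largest member. It is invariant, and a small piece
  -- of its complement could be adjoined to it, so the complement is empty.
  let 𝒰 : Set (Set X) := {U | IsOpen U ∧ ∀ A ⊆ U, A.Nonempty → small A}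
  have small_of_inter : ∀ A U : Set X, IsOpen U → small (A ∩ U) → small A := by
    rintro A U hU ⟨O, hO, hne, hO'⟩
    have heq : O ∩ U ∩ A = O ∩ (A ∩ U) := by
      rw [Set.inter_assoc, Set.inter_comm U]
    exact ⟨O ∩ U, hO.inter hU, heq ▸ hne, heq ▸ hO'⟩
  have hopen : IsOpen (⋃₀ 𝒰) := isOpen_sUnion fun U hU => hU.1
  have hmem : ⋃₀ 𝒰 ∈ 𝒰 := by
    refine ⟨hopen, fun A hA hne => ?_⟩
    obtain ⟨a, ha⟩ := hne
    obtain ⟨U, hU, haU⟩ := hA ha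
    exact small_of_inter A U hU.1 (hU.2 _ Set.inter_subset_right ⟨a, ha, haU⟩)
  have hinv : ∀ (g : G) (U : Set X), U ∈ 𝒰 → (fun x => g • x) ⁻¹' U ∈ 𝒰 := by
    rintro g U ⟨hU, hUs⟩
    refine ⟨hU.preimage (continuous_const_smul g), fun A hA hne => ?_⟩
    obtain ⟨O, hO, ⟨_, hzO, z, hz, rfl⟩, hsmall⟩ := hUs ((fun x => g • x) '' A)
      (Set.image_subset_iff.2 hA) (hne.image _)
    refine ⟨(fun x => g • x) ⁻¹' O, hO.preimage (continuous_const_smul g), ⟨z, hzO, hz⟩, ?_⟩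
    intro k x hx y hy
    -- Since `k • x = (k * g⁻¹) • (g • x)`, uniformity over all of `G` makes smallness invariant.
    have := hsmall (k * g⁻¹) (g • x) ⟨hx.1, x, hx.2, rfl⟩ (g • y) ⟨hy.1, y, hy.2, rfl⟩
    simpa [smul_smul] using this
  by_cases hY : (⋃₀ 𝒰)ᶜ.Nonempty
  · obtain ⟨O, hO, ⟨z, hzO, hz⟩, hsmall⟩ := h _ hopen.isClosed_compl (by
      intro g y hy hgy
      exact hy ⟨_, hinv g _ hmem, hgy⟩) hY ε hε
    refine absurd ⟨O ∪ ⋃₀ 𝒰, ⟨hO.union hopen, fun A hA hne => ?_⟩, Or.inl hzO⟩ hz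
    by_cases hAU : (A ∩ ⋃₀ 𝒰).Nonempty
    · exact small_of_inter A _ hopen (hmem.2 _ Set.inter_subset_right hAU)
    · have hAO : A ⊆ O ∩ (⋃₀ 𝒰)ᶜ := fun a ha =>
        have hn : a ∉ ⋃₀ 𝒰 := fun hau => hAU ⟨a, ha, hau⟩
        ⟨(hA ha).resolve_right hn, hn⟩
      obtain ⟨a, ha⟩ := hne
      exact ⟨Set.univ, isOpen_univ, ⟨a, trivial, ha⟩,
        fun g x hx y hy => hsmall g x (hAO hx.2) y (hAO hy.2)⟩
  · rw [Set.not_nonempty_iff_eq_empty, Set.compl_empty_iff] at hY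
    exact hmem.2 A₀ (hY ▸ Set.subset_univ _) hA₀

theorem hasSmallOscillations_of_hasDenseGδContinuity [CompactSpace X] [T2Space X]
    [ContinuousConstSMul G X] {f : C(X, ℝ)}
    (h : ∀ Y : Set X, IsClosed Y → (∀ g : G, ∀ y ∈ Y, g • y ∈ Y) → HasDenseGδContinuity G f Y) :
    HasSmallOscillations fun (g : G) (x : X) => f (g • x) := by
  refine hasSmallOscillations_of_invariant fun Y hY hinv hne ε hε => ?_
  obtain ⟨Y₀, hG, hd, hc⟩ := h Y hY hinv
  have : CompactSpace Y := isCompact_iff_compactSpace.1 hY.isCompact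
  have : Nonempty Y := hne.to_subtype
  obtain ⟨O, hO, ⟨z, hz⟩, hsmall⟩ := exists_open_small_oscillation_of_isGδ
    (fun g : G => (⟨fun y : Y => f (g • (y : X)), by fun_prop⟩ : C(Y, ℝ)))
    (K := (fun ψ y => ψ (y : X)) '' envelopingFamily G f)
    ((isCompact_envelopingFamily f).image
      (continuous_pi fun y => continuous_apply (y : X)))
    (fun g => ⟨_, smul_mem_envelopingFamily f g, rfl⟩) hG hd
    (by
      rintro _ ⟨_, ⟨p, hp, rfl⟩, rfl⟩
      exact continuousOn_iff_continuous_domRestrict.2 (hc p hp)) hε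
  obtain ⟨W, hW, rfl⟩ := isOpen_induced_iff.1 hO
  exact ⟨W, hW, ⟨z, hz, z.2⟩, fun g x hx y hy =>
    hsmall g ⟨x, hx.2⟩ hx.1 ⟨y, hy.2⟩ hy.1⟩

end Action

theorem mainTheorem5 {G X : Type*} [Group G] [TopologicalSpace G] [IsTopologicalGroup G]
    [TopologicalSpace X] [CompactSpace X] [T2Space X] [MulAction G X] [ContinuousSMul G X]
    (f : C(X, ℝ)) :
    List.TFAE [
      IsAsplundFunction G f,
      IsFragmentedFamily (envelopingFamily G f),
      IsBarelyContinuousFamily (envelopingFamily G f),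
      ∀ Y : Set X, IsClosed Y → HasDenseGδContinuity G f Y,
      ∀ Y : Set X, IsClosed Y → (∀ g : G, ∀ y ∈ Y, g • y ∈ Y) → HasDenseGδContinuity G f Y] := by
  rw [isFragmentedFamily_envelopingFamily_iff]
  tfae_have 1 → 2 := fun h => h.hasSmallOscillations
  tfae_have 2 → 1 := fun h => h.isAsplundFunction
  tfae_have 2 → 3 := fun h => h.isBarelyContinuousFamily
  tfae_have 3 → 2 := fun h => h.hasSmallOscillations
  tfae_have 2 → 4 := fun h Y hY => h.hasDenseGδContinuity hY
  tfae_have 4 → 5 := fun h Y hY _ => h Y hY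
  tfae_have 5 → 2 := hasSmallOscillations_of_hasDenseGδContinuity
  tfae_finish
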